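/- **Setting.** The vocabulary consists of $s\ge 2$ keys $k_0,\dots,k_{s-1}$ and $s$ values $v_0,\dots,v_{s-1}$. An instance of *associative recall* is a sequence $x=(x_1,\dots,x_L)$, $L=2n+1$, whose odd entries are keys and whose even entries are values, together with a map $f$ from keys to values (identified with a map of $\{0,\dots,s-1\}$ to itself) such that $x_{2i}=f(x_{2i-1})$ for $1\le i\le n$, and whose last entry, the query $x_L$, is one of $x_1,x_3,\dots,x_{L-2}$. The number $n$ of pairs and the map $f$ are arbitrary, and each key occurs in at most $r$ of the pairs, where $r$ is a fixed bound ($r=1$: distinct keys). The task is to output $f(x_L)$. **Layer.** A MultiHyena layer with $M$ heads of width $N$ (total width $D=MN$) computes projections $q^m_t,k^m_t,v^m_t\in\mathbb R^N$ from the tokens $x_{t-1},x_t$, forms $z^m_t=k^m_t\otimes v^m_t$, convolves causally with a long filter $h^m$, and outputs, concatenated over the heads, $y^m_t=(h^m*z^m)_tq^m_t=\sum_{j\le t}h^m_{t-j}\langle q^m_t,k^m_j\rangle v^m_j$. **Construction.** For an integer $c\ge1$ let $B=c\lceil\sqrt s\rceil$, $P=\lceil\log_2 s\rceil$, $N=BP$,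 and index $\mathbb R^N$ by pairs (bucket, bit). Let $R\in\mathbb R^{N\times s}$ be the Johnson–Lindenstrauss matrix with independent uniform entries $\pm1/\sqrt N$, shared by all heads, let $h:\{0,\dots,s-1\}\to\{1,\dots,B\}$ be a hash function all of whose fibres have at most $\lceil\sqrt s\rceil$ elements, and let $\sigma_m(i)$ ($1\le m\le M$, $0\le i<s$) be independent uniform signs, independent of $R$. All filters are the cumulative sum $h^m_t=1$. If $x_t=k_i$ is a key then $q^m_t$ is the $i$-th column of $R$, and $q^m_t=0$ if $x_t$ is a value; $k^m_t=q^m_{t-1}$ (with $k^m_1=0$). If $x_{t-1}=k_i$ and $x_t=v_j$ then $v^m_t$ is $\sigma_m(i)$ times the $P$-bit binary expansion of $j$, placed in bucket $h(i)$ and $0$ in all other buckets; $v^m_t=0$ if $x_t$ is a key. **Decoder.** From the output at position $L$, average over the heads, $\bar y=\frac1M\sum_m|y^m_L|$ (entrywise absolute values), round each entry of $\bar y$ to the nearest integer, and return the number whose $p$-th binary digit is $1$ exactly when the $p$-th coordinate of some bucket is rounded to a nonzero integer. **Theorem.** For every $r\in\mathbb N$ and every $a\in\mathbb R$ there are an integer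 $c\ge1$ and a real $C>0$ such that for every $s\ge2$ the head width satisfies $N\le C\sqrt s\,\log s$, and for every number of heads $1\le M\le a\log s$, every hash function $h$ as above, and every associative recall instance $x$ with map $f$ in which each key occurs in at most $r$ pairs, the layer followed by the decoder outputs $f(x_L)$ with probability at least $1-\frac1s$ over the random signs. In particular, a single MultiHyena layer with $O(\log s)$ heads of width $N=O(\sqrt s\log s)$ solves associative recall with high probability. (For $M=1$ the total width $D=N$ is $O(\sqrt s\log s)$ as well.) -/

import Mathlib

namespace HyenaRecall

/-! ### The MultiHyena layer -/

/-- A MultiHyena layer with `M` heads of width `N` (model width `D = M * N`) reading tokens from the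
alphabet `T`. Each head has a long convolution filter and three projections; a projection at time
`t` is computed from a short window of length two, i.e. from the token at time `t` and the token at
time `t - 1` (`none` when `t` is the first position). The parameters do not depend on the input. -/
structure MultiHyena (T : Type) (M N : ℕ) where
  filter : Fin M → ℕ → ℝ
  projQ : Fin M → Option T → T → Fin N → ℝ
  projK : Fin M → Option T → T → Fin N → ℝ
  projV : Fin M → Option T → T → Fin N → ℝ

/-- The token preceding position `t`, if there is one. -/
def prevToken {T : Type} {L : ℕ} (x : Fin L → T) (t : Fin L) : Option T :=
  if (t : ℕ) = 0 then none else some (x ⟨(t : ℕ) - 1, lt_of_le_of_lt (Nat.sub_le _ _) t.isLt⟩)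

/-- Causal convolution `(h * z)_t = ∑_{j ≤ t} h_{t-j} z_j` of a scalar filter with a sequence of
`N × N` matrices (the same filter acts on all matrix entries). -/
noncomputable def causalConv {L N : ℕ} (h : ℕ → ℝ) (z : Fin L → Matrix (Fin N) (Fin N) ℝ)
    (t : Fin L) : Matrix (Fin N) (Fin N) ℝ :=
  ∑ j ∈ Finset.Iic t, h ((t : ℕ) - (j : ℕ)) • z j

/-- One head: form the outer products `z_t = k_t ⊗ v_t`, convolve with the long filter, and contract
the key index with the query, giving `y_t = ∑_{j ≤ t} h_{t-j} ⟨q_t, k_j⟩ v_j`. -/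
noncomputable def hyenaHead {L N : ℕ} (h : ℕ → ℝ) (q k v : Fin L → Fin N → ℝ) (t : Fin L) :
    Fin N → ℝ :=
  Matrix.vecMul (q t) (causalConv h (fun j => Matrix.vecMulVec (k j) (v j)) t)

/-- The output `y ∈ ℝ^{L × M × N}` of the layer, the concatenation of the outputs of the heads. -/
noncomputable def MultiHyena.forward {T : Type} {M N L : ℕ} (layer : MultiHyena T M N)
    (x : Fin L → T) (t : Fin L) (m : Fin M) : Fin N → ℝ :=
  hyenaHead (layer.filter m)
    (fun j => layer.projQ m (prevToken x j) (x j))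
    (fun j => layer.projK m (prevToken x j) (x j))
    (fun j => layer.projV m (prevToken x j) (x j)) t

/-! ### Associative recall -/

/-- The vocabulary: `s` keys and `s` values. -/
inductive Token (s : ℕ) where
  | key (i : Fin s) : Token s
  | val (j : Fin s) : Token s

/-- `x = (k_1, f k_1, k_2, f k_2, …, k_n, f k_n, q)` is an instance of associative recall with `n`
pairs, association `f` and query `q`: the query has occurred as a key, and every key occurs in at
most `r` of the pairs (`r = 1`: the keys are distinct). The required answer is the value `f q`. -/
structure IsRecallInstance {s n : ℕ} (r : ℕ) (f : Fin s → Fin s) (q : Fin s)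
    (x : Fin (2 * n + 1) → Token s) : Prop where
  pair : ∀ i : Fin n, ∃ a : Fin s,
    x ⟨2 * (i : ℕ), by omega⟩ = Token.key a ∧ x ⟨2 * (i : ℕ) + 1, by omega⟩ = Token.val (f a)
  query : x (Fin.last (2 * n)) = Token.key q
  query_mem : ∃ i : Fin n, x ⟨2 * (i : ℕ), by omega⟩ = Token.key q
  mult : ∀ a : Fin s, {i : Fin n | x ⟨2 * (i : ℕ), by omega⟩ = Token.key a}.ncard ≤ r

/-! ### The randomized construction -/

/-- Number of bits used to write the index of a value, `⌈log₂ s⌉`. -/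
def numBits (s : ℕ) : ℕ := Nat.clog 2 s

/-- Number of hash buckets, `c ⌈√s⌉`. -/
noncomputable def numBuckets (c s : ℕ) : ℕ := c * ⌈Real.sqrt s⌉₊

/-- Width of a head: one coordinate for each pair (bucket, bit). -/
noncomputable def headWidth (c s : ℕ) : ℕ := numBuckets c s * numBits s

/-- `±1` from a bit. -/
def sgn (b : Bool) : ℝ := if b then 1 else -1

/-- The random bits of the construction: the signs of the Johnson–Lindenstrauss matrix (shared by
all heads), and fresh signs of the measurement matrix for each head. -/
abbrev Seed (c s M : ℕ) : Type := (Fin (headWidth c s) → Fin s → Bool) × (Fin M → Fin s → Bool)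

/-- The Johnson–Lindenstrauss matrix `R ∈ ℝ^{N × s}` with random entries `±1/√N`. -/
noncomputable def jlMatrix {c s M : ℕ} (ω : Seed c s M) : Matrix (Fin (headWidth c s)) (Fin s) ℝ :=
  fun l i => sgn (ω.1 l i) / Real.sqrt (headWidth c s)

/-- The row of the heavy-hitter measurement matrix `S^{(m)}` that stores value `j` under key `i`:
the binary digits of `j`, times the random sign of `i`, placed in the bucket `h i`; all other
coordinates are `0`. -/
noncomputable def measurementRow {c s M : ℕ} (h : Fin s → Fin (numBuckets c s)) (ω : Seed c s M)
    (m : Fin M) (i j : Fin s) : Fin (headWidth c s) → ℝ :=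
  fun l =>
    let bp : Fin (numBuckets c s) × Fin (numBits s) := finProdFinEquiv.symm l
    if h i = bp.1 ∧ (j : ℕ).testBit bp.2 = true then sgn (ω.2 m i) else 0

/-- The embedding of keys: the corresponding column of `R`; values are sent to `0`. -/
noncomputable def keyEmbedding {c s M : ℕ} (ω : Seed c s M) :
    Token s → Fin (headWidth c s) → ℝ
  | Token.key i => fun l => jlMatrix ω l i
  | Token.val _ => 0

/-- The MultiHyena layer of the construction: all filters are `∑ X^i` (cumulative sums), queries
embed the current token, keys are the queries delayed by one step, and values are rows of the
measurement matrices. -/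
noncomputable def recallLayer {c s M : ℕ} (h : Fin s → Fin (numBuckets c s)) (ω : Seed c s M) :
    MultiHyena (Token s) M (headWidth c s) where
  filter := fun _ _ => 1
  projQ := fun _ _ cur => keyEmbedding ω cur
  projK := fun _ prev _ =>
    match prev with
    | some tok => keyEmbedding ω tok
    | none => 0
  projV := fun m prev cur =>
    match prev, cur with
    | some (Token.key i), Token.val j => measurementRow h ω m i j
    | _, _ => 0

/-! ### The decoder -/

/-- Average over the heads of the absolute values of the measurements. -/
noncomputable def averageHeads {M N : ℕ} (y : Fin M → Fin N → ℝ) (l : Fin N) : ℝ :=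
  (∑ m, |y m l|) / M

/-- The decoder: average the heads, round every coordinate to the nearest integer, and read off the
number whose `p`-th binary digit is `1` exactly when the `p`-th coordinate of some bucket has been
rounded to a nonzero integer. It depends only on `s` and on the output `y` at the last position. -/
noncomputable def decode {c s M : ℕ} (y : Fin M → Fin (headWidth c s) → ℝ) : ℕ :=
  open Classical in
  ∑ p : Fin (numBits s),
    if ∃ b : Fin (numBuckets c s), round (averageHeads y (finProdFinEquiv (b, p))) ≠ 0
    then 2 ^ (p : ℕ) else 0

/-- The probability, over uniformly random signs, that the layer followed by the decoder answers
the query correctly on the input `x`. -/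
noncomputable def successProb {c s n : ℕ} (M : ℕ) (h : Fin s → Fin (numBuckets c s))
    (f : Fin s → Fin s) (q : Fin s) (x : Fin (2 * n + 1) → Token s) : ℝ :=
  (ProbabilityTheory.uniformOn (Set.univ : Set (Seed c s M))).real
    {ω | decode ((recallLayer h ω).forward x (Fin.last (2 * n))) = (f q : ℕ)}

end HyenaRecall

namespace HyenaRecall

open Finset

/-! ### Concentration of Johnson–Lindenstrauss inner products -/

/-! Since all filters are constant, the output of a head at the query `q` is a sum over keys `b` of
multiplicity times measurement row times the inner product of columns `q` and `b` of `R`. The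
diagonal inner product is exactly 1, so the term `b = q` is an exact signal: up to sign, the
multiplicity of `q` on the one-bits of `f q` in bucket `h q`. Everything else is noise
(`forward_recallLayer_eq_signal_add_noise`).

In a fixed coordinate only keys of a single bucket contribute, so the squared noise weights sum to
at most `r ^ 2 * ⌈√s⌉₊` (`sum_noiseWeight_sq_le`). For every fixed choice of the head signs the
noise is sub-Gaussian in `R`, with variance proxy that bound divided by `N`
(`card_half_le_abs_sum_mul_colInner`). The randomness of the head signs is never needed.

A union bound over the `M * N` coordinates makes all noise terms smaller than 1/2. Averaging
absolute values preserves this error, and rounding then recovers the multiplicities exactly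
(`decode_forward_eq_of_noise_lt`). -/

lemma sgn_mul_sgn (a b : Bool) : sgn a * sgn b = sgn (a == b) := by
  cases a <;> cases b <;> simp [sgn]

lemma sgn_sq (a : Bool) : sgn a ^ 2 = 1 := by
  cases a <;> simp [sgn]

/-- A Rademacher sum with coefficients `w` is sub-Gaussian with variance proxy `∑ wₐ²`. -/
lemma sum_exp_sum_mul_sgn_le {ι : Type*} [Fintype ι] [DecidableEq ι] (w : ι → ℝ) :
    ∑ e : ι → Bool, Real.exp (∑ a, w a * sgn (e a)) ≤
      2 ^ Fintype.card ι * Real.exp ((∑ a, w a ^ 2) / 2) := by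
  have key := Finset.prod_univ_sum (fun _ : ι => (univ : Finset Bool))
    (fun a b => Real.exp (w a * sgn b))
  rw [Fintype.piFinset_univ] at key
  simp_rw [Real.exp_sum]
  rw [← key, Finset.sum_div, Real.exp_sum, Fintype.card, ← Finset.prod_const,
    ← Finset.prod_mul_distrib]
  refine Finset.prod_le_prod (fun a _ => Finset.sum_nonneg fun b _ => (Real.exp_pos _).le)
    fun a _ => ?_
  have h := Real.cosh_le_exp_half_sq (w a)
  rw [Real.cosh_eq] at h
  simp only [Fintype.sum_bool, sgn]
  simp only [if_true, Bool.false_eq_true, if_false, mul_one, mul_neg]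
  linarith

/-- Multiplying all signs but the one of `q` by the sign of `q`. -/
def twistSigns {ι : Type*} [DecidableEq ι] (q : ι) (e : ι → Bool) (a : ι) : Bool :=
  if a = q then e q else (e a == e q)

lemma twistSigns_involutive {ι : Type*} [DecidableEq ι] (q : ι) :
    Function.Involutive (twistSigns q) := by
  intro e
  funext a
  by_cases h : a = q
  · simp [twistSigns, h]
  · simp only [twistSigns, h, if_false, if_true]
    cases e a <;> cases e q <;> rfl

/-- Multiplying the other signs by that of `q` permutes the sign vectors, so the products are again
independent signs; `w q = 0` removes the only term where this fails. -/
lemma sum_exp_sum_mul_sgn_mul_sgn_le {ι : Type*} [Fintype ι] [DecidableEq ι] (w : ι → ℝ) {q : ι}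
    (hq : w q = 0) :
    ∑ e : ι → Bool, Real.exp (∑ a, w a * (sgn (e q) * sgn (e a))) ≤
      2 ^ Fintype.card ι * Real.exp ((∑ a, w a ^ 2) / 2) := by
  refine le_of_eq_of_le ?_ (sum_exp_sum_mul_sgn_le w)
  refine Fintype.sum_equiv (twistSigns_involutive q).toPerm _ _ fun e => ?_
  congr 1
  refine Finset.sum_congr rfl fun a _ => ?_
  by_cases h : a = q
  · simp [h, hq]
  · rw [mul_comm (sgn (e q)), sgn_mul_sgn]
    simp [twistSigns, h]

/-- The rows of `R` are independent, so the exponential moment is a power of that of one row. -/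
lemma sum_exp_sum_rows_le {κ ι : Type*} [Fintype κ] [DecidableEq κ] [Fintype ι] [DecidableEq ι]
    (w : ι → ℝ) {q : ι} (hq : w q = 0) :
    ∑ R : κ → ι → Bool, Real.exp (∑ l, ∑ a, w a * (sgn (R l q) * sgn (R l a))) ≤
      Fintype.card (κ → ι → Bool) * Real.exp (Fintype.card κ * ((∑ a, w a ^ 2) / 2)) := by
  have key := Finset.prod_univ_sum (fun _ : κ => (univ : Finset (ι → Bool)))
    (fun _ e => Real.exp (∑ a, w a * (sgn (e q) * sgn (e a))))
  rw [Fintype.piFinset_univ] at key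
  simp_rw [Real.exp_sum univ fun l => ∑ a, w a * (_ * _)]
  rw [← key, Finset.prod_const, Real.exp_nat_mul]
  have h2 : (Fintype.card (κ → ι → Bool) : ℝ) = (2 ^ Fintype.card ι) ^ Fintype.card κ := by
    simp
  rw [h2, ← mul_pow]
  exact pow_le_pow_left₀ (Finset.sum_nonneg fun b _ => (Real.exp_pos _).le)
    (sum_exp_sum_mul_sgn_mul_sgn_le w hq) _

/-- Inner product of columns `q` and `a` of the `±1/√N` matrix with signs `R`. -/
noncomputable def colInner {κ ι : Type*} [Fintype κ] (R : κ → ι → Bool) (q a : ι) : ℝ :=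
  (∑ l, sgn (R l q) * sgn (R l a)) / Fintype.card κ

lemma colInner_self {κ ι : Type*} [Fintype κ] [Nonempty κ] (R : κ → ι → Bool) (q : ι) :
    colInner R q q = 1 := by
  simp [colInner, ← sq, sgn_sq]

lemma sum_mul_colInner {κ ι : Type*} [Fintype κ] [Fintype ι] (R : κ → ι → Bool) (q : ι)
    (w : ι → ℝ) (μ : ℝ) :
    μ * ∑ a, w a * colInner R q a =
      ∑ l, ∑ a, μ * w a / Fintype.card κ * (sgn (R l q) * sgn (R l a)) := by
  rw [Finset.sum_comm, Finset.mul_sum]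
  refine Finset.sum_congr rfl fun a _ => ?_
  rw [← Finset.mul_sum, colInner]
  ring

lemma sum_exp_mul_colInner_le {κ ι : Type*} [Fintype κ] [DecidableEq κ] [Nonempty κ] [Fintype ι]
    [DecidableEq ι] {w : ι → ℝ} {q : ι} (hq : w q = 0) {V : ℝ} (hV : ∑ a, w a ^ 2 ≤ V) (μ : ℝ) :
    ∑ R : κ → ι → Bool, Real.exp (μ * ∑ a, w a * colInner R q a) ≤
      Fintype.card (κ → ι → Bool) * Real.exp (μ ^ 2 * V / (2 * Fintype.card κ)) := by
  simp_rw [sum_mul_colInner]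
  refine (sum_exp_sum_rows_le (fun a => μ * w a / Fintype.card κ) (by simp [hq])).trans ?_
  have hκ : (0 : ℝ) < Fintype.card κ := by exact_mod_cast Fintype.card_pos
  gcongr
  have h : ∑ a, (μ * w a / Fintype.card κ) ^ 2 =
      μ ^ 2 / (Fintype.card κ : ℝ) ^ 2 * ∑ a, w a ^ 2 := by
    rw [Finset.mul_sum]
    exact Finset.sum_congr rfl fun a _ => by ring
  rw [h]
  calc (Fintype.card κ : ℝ) * (μ ^ 2 / (Fintype.card κ : ℝ) ^ 2 * (∑ a, w a ^ 2) / 2)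
      = μ ^ 2 * (∑ a, w a ^ 2) / (2 * Fintype.card κ) := by field_simp
    _ ≤ _ := by gcongr

/-- Chernoff bound for a linear combination of inner products with column `q`. -/
lemma card_half_le_abs_sum_mul_colInner {κ ι : Type*} [Fintype κ] [DecidableEq κ] [Nonempty κ]
    [Fintype ι] [DecidableEq ι] {w : ι → ℝ} {q : ι} (hq : w q = 0) {V : ℝ}
    (hV : ∑ a, w a ^ 2 ≤ V) {μ : ℝ} (hμ : 0 ≤ μ) :
    (#{R : κ → ι → Bool | 1 / 2 ≤ |∑ a, w a * colInner R q a|} : ℝ) ≤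
      2 * Real.exp (μ ^ 2 * V / (2 * Fintype.card κ) - μ / 2) *
        Fintype.card (κ → ι → Bool) := by
  have h1 := sum_exp_mul_colInner_le (κ := κ) hq hV μ
  have h2 := sum_exp_mul_colInner_le (κ := κ) hq hV (-μ)
  rw [neg_sq] at h2
  -- Markov's inequality for both tails at once: on the bad event one of the two exponentials is at
  -- least `exp (μ / 2)`.
  have h3 : (#{R : κ → ι → Bool | 1 / 2 ≤ |∑ a, w a * colInner R q a|} : ℝ) * Real.exp (μ / 2) ≤
      ∑ R : κ → ι → Bool, (Real.exp (μ * ∑ a, w a * colInner R q a) +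
        Real.exp (-μ * ∑ a, w a * colInner R q a)) := by
    rw [← nsmul_eq_mul, ← Finset.sum_const]
    refine (Finset.sum_le_sum fun R hR => ?_).trans
      (Finset.sum_le_univ_sum_of_nonneg fun R => by positivity)
    rw [Finset.mem_filter] at hR
    rcases le_abs.1 hR.2 with h | h
    · exact (Real.exp_le_exp.2 (by nlinarith)).trans
        (le_add_of_nonneg_right (Real.exp_pos _).le)
    · exact (Real.exp_le_exp.2 (by nlinarith)).trans
        (le_add_of_nonneg_left (Real.exp_pos _).le)
  rw [Finset.sum_add_distrib] at h3
  rw [Real.exp_sub, mul_div_assoc', div_mul_eq_mul_div, le_div_iff₀ (Real.exp_pos _)]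
  linarith

/-! ### The output of the layer at the query -/

lemma sum_fin_two_mul_add_one {β : Type*} [AddCommMonoid β] {n : ℕ} (g : Fin (2 * n + 1) → β) :
    ∑ t, g t = ∑ i : Fin n, (g ⟨2 * i, by omega⟩ + g ⟨2 * i + 1, by omega⟩) +
      g (Fin.last (2 * n)) := by
  induction n with
  | zero => simp
  | succ n ih =>
    rw [Fin.sum_univ_castSucc]
    congr 1
    refine (Fin.sum_univ_castSucc (n := 2 * n + 1) fun t => g t.castSucc).trans ?_
    rw [ih, Fin.sum_univ_castSucc, add_assoc]
    rfl

lemma hyenaHead_one_last {L N : ℕ} (q k v : Fin (L + 1) → Fin N → ℝ) (l : Fin N) :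
    hyenaHead (fun _ => 1) q k v (Fin.last L) l = ∑ j, (q (Fin.last L) ⬝ᵥ k j) * v j l := by
  have : (Finset.Iic (Fin.last L) : Finset (Fin (L + 1))) = univ := by
    ext j; simp [Fin.le_last]
  simp only [hyenaHead, causalConv, one_smul, this, Matrix.vecMul, dotProduct, Matrix.sum_apply,
    Matrix.vecMulVec_apply, Finset.mul_sum, Finset.sum_mul]
  rw [Finset.sum_comm]
  exact Finset.sum_congr rfl fun j _ => Finset.sum_congr rfl fun i _ => by ring

lemma keyEmbedding_dotProduct {c s M : ℕ} (ω : Seed c s M) (i j : Fin s) :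
    keyEmbedding ω (Token.key i) ⬝ᵥ keyEmbedding ω (Token.key j) = colInner ω.1 i j := by
  simp only [dotProduct, keyEmbedding, jlMatrix, colInner, Finset.sum_div, Fintype.card_fin]
  refine Finset.sum_congr rfl fun l _ => ?_
  rw [div_mul_div_comm, Real.mul_self_sqrt (Nat.cast_nonneg _)]

/-- Number of pairs with key `b`. -/
noncomputable def keyCount {s n : ℕ} (x : Fin (2 * n + 1) → Token s) (b : Fin s) : ℕ :=
  {i : Fin n | x ⟨2 * (i : ℕ), by omega⟩ = Token.key b}.ncard

lemma forward_recallLayer_last {c s n M r : ℕ} (h : Fin s → Fin (numBuckets c s)) (ω : Seed c s M)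
    {f : Fin s → Fin s} {q : Fin s} {x : Fin (2 * n + 1) → Token s}
    (hx : IsRecallInstance r f q x) (m : Fin M) (l : Fin (headWidth c s)) :
    (recallLayer h ω).forward x (Fin.last (2 * n)) m l =
      ∑ b, keyCount x b * measurementRow h ω m b (f b) l * colInner ω.1 q b := by
  choose a ha ha' using hx.pair
  -- Positions are counted from 0, so keys sit at even positions, where the value projection
  -- vanishes; only the odd positions contribute, each carrying the key one step before it.
  have hlast : (recallLayer h ω).projV m (prevToken x (Fin.last (2 * n))) (x (Fin.last (2 * n))) =
      0 := by
    rw [hx.query]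
    simp only [recallLayer]
    cases prevToken x (Fin.last (2 * n)) with
    | none => rfl
    | some tok => cases tok <;> rfl
  have heven (i : Fin n) : (recallLayer h ω).projV m (prevToken x ⟨2 * i, by omega⟩)
      (x ⟨2 * i, by omega⟩) = 0 := by
    rw [ha]
    simp only [recallLayer]
    cases prevToken x ⟨2 * i, by omega⟩ with
    | none => rfl
    | some tok => cases tok <;> rfl
  have hprev (i : Fin n) : prevToken x ⟨2 * i + 1, by omega⟩ = some (Token.key (a i)) := by
    rw [← ha i]
    simp [prevToken]
  have hodd (i : Fin n) : (recallLayer h ω).projV m (prevToken x ⟨2 * i + 1, by omega⟩)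
      (x ⟨2 * i + 1, by omega⟩) = measurementRow h ω m (a i) (f (a i)) := by
    rw [ha', hprev]
    rfl
  have hk (i : Fin n) : (recallLayer h ω).projK m (prevToken x ⟨2 * i + 1, by omega⟩)
      (x ⟨2 * i + 1, by omega⟩) = keyEmbedding ω (Token.key (a i)) := by
    rw [hprev]
    rfl
  have hq : (recallLayer h ω).projQ m (prevToken x (Fin.last (2 * n))) (x (Fin.last (2 * n))) =
      keyEmbedding ω (Token.key q) := by
    rw [hx.query]
    rfl
  have hcount (b : Fin s) : keyCount x b = #{i : Fin n | a i = b} := by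
    rw [keyCount, ← Set.ncard_coe_finset]
    congr 1
    ext i
    simp [ha]
  have hform : (recallLayer h ω).forward x (Fin.last (2 * n)) m l =
      ∑ i, colInner ω.1 q (a i) * measurementRow h ω m (a i) (f (a i)) l := by
    change hyenaHead (fun _ => 1) _ _ _ _ _ = _
    rw [hyenaHead_one_last, sum_fin_two_mul_add_one]
    simp only [hlast, heven, hodd, hk, hq, keyEmbedding_dotProduct, Pi.zero_apply, mul_zero,
      zero_add, add_zero]
  rw [hform, ← Finset.sum_fiberwise univ a]
  refine Finset.sum_congr rfl fun b _ => ?_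
  rw [Finset.sum_congr rfl (g := fun _ => colInner ω.1 q b * measurementRow h ω m b (f b) l)
    (fun i hi => by rw [(Finset.mem_filter.1 hi).2]), Finset.sum_const, nsmul_eq_mul, hcount]
  ring

/-- The weight in coordinate `l` of the pairs whose key is not the query. -/
noncomputable def noiseWeight {c s n M : ℕ} (h : Fin s → Fin (numBuckets c s))
    (σ : Fin M → Fin s → Bool) (f : Fin s → Fin s) (q : Fin s) (x : Fin (2 * n + 1) → Token s)
    (m : Fin M) (l : Fin (headWidth c s)) (b : Fin s) : ℝ :=
  if b = q then 0
  else keyCount x b * measurementRow h (fun _ _ => true, σ) m b (f b) l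

lemma forward_recallLayer_eq_signal_add_noise {c s n M r : ℕ} [NeZero (headWidth c s)]
    (h : Fin s → Fin (numBuckets c s)) (ω : Seed c s M)
    {f : Fin s → Fin s} {q : Fin s} {x : Fin (2 * n + 1) → Token s}
    (hx : IsRecallInstance r f q x) (m : Fin M) (l : Fin (headWidth c s)) :
    (recallLayer h ω).forward x (Fin.last (2 * n)) m l =
      keyCount x q * measurementRow h ω m q (f q) l +
        ∑ b, noiseWeight h ω.2 f q x m l b * colInner ω.1 q b := by
  rw [forward_recallLayer_last h ω hx, ← Finset.add_sum_erase _ _ (mem_univ q), colInner_self,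
    mul_one]
  congr 1
  rw [← Finset.add_sum_erase univ (fun b => noiseWeight h ω.2 f q x m l b * colInner ω.1 q b)
    (mem_univ q)]
  simp only [noiseWeight, if_true, zero_mul, zero_add]
  refine Finset.sum_congr rfl fun b hb => ?_
  rw [if_neg (Finset.ne_of_mem_erase hb)]
  -- `measurementRow` reads only the head signs, so the dummy matrix signs in `noiseWeight` are
  -- harmless; they make the weights visibly independent of `R`.
  rfl

lemma sum_noiseWeight_sq_le {c s n M r : ℕ} {h : Fin s → Fin (numBuckets c s)}
    (hh : ∀ b, {i : Fin s | h i = b}.ncard ≤ ⌈Real.sqrt s⌉₊) (σ : Fin M → Fin s → Bool)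
    {f : Fin s → Fin s} {q : Fin s} {x : Fin (2 * n + 1) → Token s}
    (hx : IsRecallInstance r f q x) (m : Fin M) (l : Fin (headWidth c s)) :
    ∑ b, noiseWeight h σ f q x m l b ^ 2 ≤ (r : ℝ) ^ 2 * ⌈Real.sqrt s⌉₊ := by
  set β := (finProdFinEquiv.symm l : Fin (numBuckets c s) × Fin (numBits s)).1 with hβ
  have h1 (b : Fin s) : noiseWeight h σ f q x m l b ^ 2 ≤ if h b = β then (r : ℝ) ^ 2 else 0 := by
    have hc : (keyCount x b : ℝ) ≤ r := by exact_mod_cast hx.mult b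
    have hc2 : (keyCount x b : ℝ) ^ 2 ≤ (r : ℝ) ^ 2 := by gcongr
    unfold noiseWeight measurementRow
    by_cases hb : h b = β
    · simp only [hb, ← hβ, true_and, if_true]
      split_ifs <;> simp [mul_pow, sgn_sq, hc2]
    · simp [hb, ← hβ]
  refine (Finset.sum_le_sum fun b _ => h1 b).trans ?_
  rw [← Finset.sum_filter, Finset.sum_const, nsmul_eq_mul, mul_comm]
  gcongr
  refine le_of_eq_of_le ?_ (hh β)
  rw [← Set.ncard_coe_finset]
  congr 1
  ext i
  simp

/-! ### Correctness of the decoder -/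

/-- Induction on the number of bits, peeling off the least significant one. -/
lemma sum_two_pow_of_testBit {P j : ℕ} (hj : j < 2 ^ P) :
    ∑ p : Fin P, (if j.testBit p = true then 2 ^ (p : ℕ) else 0) = j := by
  induction P generalizing j with
  | zero => simp at hj ⊢; omega
  | succ P ih =>
    rw [Fin.sum_univ_succ]
    have h := ih (j := j / 2) (by rw [pow_succ] at hj; omega)
    simp only [Fin.val_succ, Nat.testBit_succ, Fin.val_zero, pow_succ, pow_zero,
      Nat.testBit_zero, decide_eq_true_eq]
    have h2 : ∑ i : Fin P, (if (j / 2).testBit i = true then 2 ^ (i : ℕ) * 2 else 0) =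
        j / 2 * 2 := by
      conv_rhs => rw [← h, Finset.sum_mul]
      exact Finset.sum_congr rfl fun i _ => by split_ifs <;> simp
    rw [h2]
    split_ifs <;> omega

lemma abs_averageHeads_sub_lt {M N : ℕ} (hM : 1 ≤ M) {y : Fin M → Fin N → ℝ} {l : Fin N}
    {t δ : ℝ} (hy : ∀ m, |(|y m l| - t)| < δ) : |averageHeads y l - t| < δ := by
  have hM' : (0 : ℝ) < M := by exact_mod_cast hM
  have : averageHeads y l - t = (∑ m, (|y m l| - t)) / M := by
    rw [averageHeads, Finset.sum_sub_distrib]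
    simp
    field_simp
  rw [this, abs_div, abs_of_pos hM', div_lt_iff₀ hM']
  have : Nonempty (Fin M) := ⟨⟨0, hM⟩⟩
  calc |∑ m, (|y m l| - t)| ≤ ∑ m, |(|y m l| - t)| := Finset.abs_sum_le_sum_abs _ _
    _ < ∑ _m : Fin M, δ := Finset.sum_lt_sum_of_nonempty univ_nonempty fun m _ => hy m
    _ = δ * M := by simp [mul_comm]

lemma round_eq_natCast_of_abs_sub_lt {u : ℝ} {k : ℕ} (hu : |u - k| < 1 / 2) : round u = k := by
  rw [round_eq, Int.floor_eq_iff]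
  rw [abs_lt] at hu
  push_cast
  constructor <;> linarith

lemma abs_abs_mul_sgn_add_sub_lt {δ e : ℝ} {k : ℕ} (b : Bool) (he : |e| < δ) :
    |(|k * sgn b + e| - k)| < δ := by
  have h1 : |(k : ℝ) * sgn b| = k := by cases b <;> simp [sgn]
  calc |(|k * sgn b + e| - k)| = |(|k * sgn b + e| - |(k : ℝ) * sgn b|)| := by rw [h1]
    _ ≤ |k * sgn b + e - k * sgn b| := abs_abs_sub_abs_le_abs_sub _ _
    _ < δ := by simpa using he

lemma decode_forward_eq_of_noise_lt {c s n M r : ℕ} [NeZero (headWidth c s)] (hM : 1 ≤ M)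
    (h : Fin s → Fin (numBuckets c s)) (ω : Seed c s M)
    {f : Fin s → Fin s} {q : Fin s} {x : Fin (2 * n + 1) → Token s}
    (hx : IsRecallInstance r f q x)
    (hω : ∀ m l, |∑ b, noiseWeight h ω.2 f q x m l b * colInner ω.1 q b| < 1 / 2) :
    decode ((recallLayer h ω).forward x (Fin.last (2 * n))) = (f q : ℕ) := by
  set y := (recallLayer h ω).forward x (Fin.last (2 * n)) with hy
  have hround (b : Fin (numBuckets c s)) (p : Fin (numBits s)) :
      round (averageHeads y (finProdFinEquiv (b, p))) =
        ((if h q = b ∧ (f q : ℕ).testBit p = true then keyCount x q else 0 : ℕ) : ℤ) := by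
    obtain ⟨l, hl⟩ : ∃ l : Fin (headWidth c s), l = finProdFinEquiv (b, p) := ⟨_, rfl⟩
    have hl' : (finProdFinEquiv.symm l : Fin (numBuckets c s) × Fin (numBits s)) = (b, p) :=
      finProdFinEquiv.symm_apply_eq.2 hl
    rw [← hl]
    refine round_eq_natCast_of_abs_sub_lt (abs_averageHeads_sub_lt hM fun m => ?_)
    rw [hy, forward_recallLayer_eq_signal_add_noise h ω hx]
    have hrow : measurementRow h ω m q (f q) l =
        if h q = b ∧ (f q : ℕ).testBit p = true then sgn (ω.2 m q) else 0 := by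
      simp [measurementRow, hl']
    rw [hrow]
    split_ifs
    · exact abs_abs_mul_sgn_add_sub_lt _ (hω _ _)
    · simpa using hω m l
  have hpos : keyCount x q ≠ 0 := by
    obtain ⟨i, hi⟩ := hx.query_mem
    exact ((Set.ncard_pos (Set.toFinite _)).2 ⟨i, hi⟩).ne'
  have hf : (f q : ℕ) < 2 ^ numBits s :=
    (f q).isLt.trans_le (Nat.le_pow_clog one_lt_two s)
  rw [decode, ← sum_two_pow_of_testBit hf]
  refine Finset.sum_congr rfl fun p _ => ?_
  congr 1
  -- Only bucket `h q` can round to a nonzero value, namely the multiplicity of `q`, which is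
  -- positive because the query has occurred.
  simp [hround, hpos]

/-! ### Union bound -/

lemma one_sub_le_successProb {c s n M : ℕ} {h : Fin s → Fin (numBuckets c s)}
    {f : Fin s → Fin s} {q : Fin s} {x : Fin (2 * n + 1) → Token s} (B : Finset (Seed c s M))
    (hB : ∀ ω ∉ B, decode ((recallLayer h ω).forward x (Fin.last (2 * n))) = (f q : ℕ)) {ε : ℝ}
    (hε : (#B : ℝ) ≤ ε * Fintype.card (Seed c s M)) : 1 - ε ≤ successProb M h f q x := by
  classical
  set μ := ProbabilityTheory.uniformOn (Set.univ : Set (Seed c s M)) with hμ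
  have hprob : MeasureTheory.IsProbabilityMeasure μ :=
    ProbabilityTheory.isProbabilityMeasure_uniformOn Set.finite_univ Set.univ_nonempty
  have hcard : (0 : ℝ) < Fintype.card (Seed c s M) := by exact_mod_cast Fintype.card_pos
  have h1 : μ.real (B : Set (Seed c s M)) = #B / Fintype.card (Seed c s M) := by
    have := ProbabilityTheory.uniformOn_apply_finset (s := (univ : Finset (Seed c s M))) (t := B)
    rw [Finset.coe_univ, Finset.univ_inter] at this
    rw [MeasureTheory.measureReal_def, hμ, this]
    simp [ENNReal.toReal_div]
  have h2 : μ.real (B : Set (Seed c s M))ᶜ = 1 - #B / Fintype.card (Seed c s M) := by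
    rw [MeasureTheory.probReal_compl_eq_one_sub B.measurableSet, h1]
  calc 1 - ε ≤ μ.real (B : Set (Seed c s M))ᶜ := by
        rw [h2]
        have := (div_le_iff₀ hcard).2 hε
        linarith
    _ ≤ _ := MeasureTheory.measureReal_mono fun ω hω => hB ω hω

/-- Fubini: a bound uniform in the second component passes to the product. It is used with the head
signs frozen. -/
lemma card_filter_prod_le {α β : Type*} [Fintype α] [Fintype β] (p : α → β → Prop)
    [∀ a b, Decidable (p a b)] {δ : ℝ} (hp : ∀ b, (#{a | p a b} : ℝ) ≤ δ * Fintype.card α) :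
    (#{ω : α × β | p ω.1 ω.2} : ℝ) ≤ δ * Fintype.card (α × β) := by
  have : #{ω : α × β | p ω.1 ω.2} = ∑ b, #{a | p a b} := by
    simp only [Finset.card_filter]
    rw [Fintype.sum_prod_type_right]
  rw [this, Nat.cast_sum, Fintype.card_prod, Nat.cast_mul]
  refine (Finset.sum_le_sum fun b _ => hp b).trans (le_of_eq ?_)
  rw [Finset.sum_const, nsmul_eq_mul, Finset.card_univ]
  ring

/-- Failure probability of the layer in terms of the Chernoff parameter `μ`. -/
lemma one_sub_union_bound_le_successProb {c s n M r : ℕ} [NeZero (headWidth c s)] (hM : 1 ≤ M)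
    {h : Fin s → Fin (numBuckets c s)} (hh : ∀ b, {i : Fin s | h i = b}.ncard ≤ ⌈Real.sqrt s⌉₊)
    {f : Fin s → Fin s} {q : Fin s} {x : Fin (2 * n + 1) → Token s}
    (hx : IsRecallInstance r f q x) {μ : ℝ} (hμ : 0 ≤ μ) :
    1 - M * headWidth c s * (2 * Real.exp
      (μ ^ 2 * ((r : ℝ) ^ 2 * ⌈Real.sqrt s⌉₊) / (2 * headWidth c s) - μ / 2)) ≤
      successProb M h f q x := by
  classical
  refine one_sub_le_successProb
    (univ.biUnion fun ml : Fin M × Fin (headWidth c s) => {ω : Seed c s M |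
      1 / 2 ≤ |∑ b, noiseWeight h ω.2 f q x ml.1 ml.2 b * colInner ω.1 q b|}) (fun ω hω => ?_) ?_
  · refine decode_forward_eq_of_noise_lt hM h ω hx fun m l => ?_
    by_contra hlt
    exact hω (Finset.mem_biUnion.2 ⟨(m, l), mem_univ _, by simpa using hlt⟩)
  · have hb (ml : Fin M × Fin (headWidth c s)) := card_filter_prod_le
      (fun (R : Fin (headWidth c s) → Fin s → Bool) (σ : Fin M → Fin s → Bool) =>
        1 / 2 ≤ |∑ b, noiseWeight h σ f q x ml.1 ml.2 b * colInner R q b|)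
      fun σ => card_half_le_abs_sum_mul_colInner (by simp [noiseWeight])
        (sum_noiseWeight_sq_le hh σ hx ml.1 ml.2) hμ
    refine (Nat.cast_le.2 Finset.card_biUnion_le).trans ?_
    rw [Nat.cast_sum]
    refine (Finset.sum_le_sum fun ml _ => hb ml).trans (le_of_eq ?_)
    rw [Finset.sum_const, nsmul_eq_mul, Finset.card_univ, Fintype.card_prod]
    simp only [Fintype.card_fin, Nat.cast_mul]
    ring

/-! ### Choice of the parameters -/

lemma one_le_numBits {s : ℕ} (hs : 2 ≤ s) : 1 ≤ numBits s := Nat.clog_pos one_lt_two hs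

lemma log_le_numBits (s : ℕ) : Real.log s ≤ numBits s := by
  rcases Nat.eq_zero_or_pos s with rfl | hs
  · simp
  have h : (s : ℝ) ≤ 2 ^ numBits s := by exact_mod_cast Nat.le_pow_clog one_lt_two s
  have h2 := Real.log_le_log (by exact_mod_cast hs) h
  rw [Real.log_pow] at h2
  have := Real.log_two_lt_d9
  nlinarith [Nat.cast_nonneg (α := ℝ) (numBits s)]

/-- From `(P - 1) log 2 ≤ log s` and `log 2 ≤ log s` one gets `P ≤ 2 log s / log 2`, below `4 log
s`. -/
lemma numBits_le_four_mul_log {s : ℕ} (hs : 2 ≤ s) : (numBits s : ℝ) ≤ 4 * Real.log s := by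
  have h : 2 ^ (numBits s - 1) < s := Nat.pow_pred_clog_lt_self one_lt_two (by omega)
  have h2 : (2 : ℝ) ^ (numBits s - 1) ≤ s := by exact_mod_cast h.le
  have h3 := Real.log_le_log (by positivity) h2
  rw [Real.log_pow, Nat.cast_sub (one_le_numBits hs), Nat.cast_one] at h3
  have h4 : Real.log 2 ≤ Real.log s := Real.log_le_log (by norm_num) (by exact_mod_cast hs)
  have := Real.log_two_gt_d9
  have h5 : (1 : ℝ) ≤ numBits s := by exact_mod_cast one_le_numBits hs
  nlinarith

lemma headWidth_le {c s : ℕ} (hs : 2 ≤ s) :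
    (headWidth c s : ℝ) ≤ 8 * c * (Real.sqrt s * Real.log s) := by
  have h1 : (1 : ℝ) ≤ Real.sqrt s := Real.one_le_sqrt.2 (by exact_mod_cast (by omega : 1 ≤ s))
  have h2 := (Nat.ceil_lt_add_one (Real.sqrt_nonneg s)).le
  have h3 := numBits_le_four_mul_log hs
  rw [headWidth, numBuckets]
  push_cast
  calc (c : ℝ) * ⌈Real.sqrt s⌉₊ * numBits s ≤ c * (2 * Real.sqrt s) * (4 * Real.log s) := by
        gcongr
        linarith
    _ = _ := by ring

lemma ceil_sqrt_le (s : ℕ) : ⌈Real.sqrt s⌉₊ ≤ s := by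
  rw [Nat.ceil_le, Real.sqrt_le_left (Nat.cast_nonneg s)]
  rcases Nat.eq_zero_or_pos s with rfl | hs
  · simp
  have : (1 : ℝ) ≤ s := by exact_mod_cast hs
  nlinarith

lemma sq_div_two_le_exp {x : ℝ} (hx : 0 ≤ x) : x ^ 2 / 2 ≤ Real.exp x := by
  linarith [Real.quadratic_le_exp_of_nonneg hx]

/-- With `c = 8 ρ² K` and `256 A ρ² K ≤ exp K`, the union bound at `μ = 4 K P` is at most `1 / s`. -/
lemma union_bound_le_inv {s M A ρ K : ℕ} (hs : 2 ≤ s) (hρ : 1 ≤ ρ) (hK : 1 ≤ K) (hA : 1 ≤ A)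
    (hM : (M : ℝ) ≤ A * Real.log s) (hAK : 256 * A * (ρ : ℝ) ^ 2 * K ≤ Real.exp K) :
    M * headWidth (8 * ρ ^ 2 * K) s * (2 * Real.exp
      ((4 * K * numBits s : ℝ) ^ 2 * ((ρ : ℝ) ^ 2 * ⌈Real.sqrt s⌉₊) /
        (2 * headWidth (8 * ρ ^ 2 * K) s) - 4 * K * numBits s / 2)) ≤ 1 / (s : ℝ) := by
  set P := numBits s with hP
  set S := ⌈Real.sqrt s⌉₊ with hS
  have hP1 : 1 ≤ P := one_le_numBits hs
  have hS1 : 0 < S := Nat.ceil_pos.2 (Real.sqrt_pos.2 (by exact_mod_cast (by omega : 0 < s)))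
  have hN : (headWidth (8 * ρ ^ 2 * K) s : ℝ) = 8 * ρ ^ 2 * K * S * P := by
    rw [headWidth, numBuckets, ← hP, ← hS]
    push_cast
    ring
  have hPr : (0 : ℝ) < P := by exact_mod_cast hP1
  have hSr : (0 : ℝ) < S := by exact_mod_cast hS1
  have hρr : (0 : ℝ) < ρ := by exact_mod_cast hρ
  have hKr : (0 : ℝ) < K := by exact_mod_cast hK
  have hsr : (0 : ℝ) < s := by exact_mod_cast (by omega : 0 < s)
  -- `μ = 4 K P` minimizes the Chernoff exponent for this width; the two terms are `K P` and `-2 K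
  -- P`.
  have hexp : (4 * K * P : ℝ) ^ 2 * ((ρ : ℝ) ^ 2 * S) / (2 * (8 * ρ ^ 2 * K * S * P)) -
      4 * K * P / 2 = -(P * K) := by
    field_simp
    ring
  rw [hN, hexp, Real.exp_neg]
  have hs2 : (s : ℝ) ≤ 2 ^ P := by exact_mod_cast Nat.le_pow_clog one_lt_two s
  have hS2 : (S : ℝ) ≤ 2 ^ P := le_trans (by exact_mod_cast ceil_sqrt_le s) hs2
  have hP2 : (P : ℝ) ≤ 2 ^ P := by exact_mod_cast Nat.lt_two_pow_self.le
  have hM2 : (M : ℝ) ≤ A * 2 ^ P := hM.trans (by gcongr; exact (log_le_numBits s).trans hP2)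
  -- Each of `M / A`, `S`, `P` and `s` is at most `2 ^ P`, which yields the factor `16 ^ P`; raising
  -- the constant to the power `P` lets everything be compared with `exp K` inside one `P`-th power.
  have hbase : (16 * A * ρ ^ 2 * K : ℝ) ≤ (16 * A * ρ ^ 2 * K : ℝ) ^ P := by
    refine le_self_pow₀ ?_ (by omega)
    exact_mod_cast (by positivity : 0 < 16 * A * ρ ^ 2 * K)
  have hE : (16 * A * ρ ^ 2 * K : ℝ) * 16 ^ P ≤ Real.exp (P * K) := by
    rw [Real.exp_nat_mul]
    calc (16 * A * ρ ^ 2 * K : ℝ) * 16 ^ P ≤ (16 * A * ρ ^ 2 * K : ℝ) ^ P * 16 ^ P := by gcongr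
      _ = (256 * A * (ρ : ℝ) ^ 2 * K) ^ P := by rw [← mul_pow]; ring
      _ ≤ _ := by gcongr
  rw [le_div_iff₀ hsr, ← mul_assoc, ← div_eq_mul_inv, div_mul_eq_mul_div,
    div_le_one (Real.exp_pos _)]
  refine le_trans ?_ hE
  calc (M * (8 * ρ ^ 2 * K * S * P) * 2 * s : ℝ)
      ≤ (A * 2 ^ P) * (8 * ρ ^ 2 * K * 2 ^ P * 2 ^ P) * 2 * 2 ^ P := by gcongr
    _ = 16 * A * ρ ^ 2 * K * (2 ^ P * 2 ^ P * 2 ^ P * 2 ^ P) := by ring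
    _ = _ := by rw [← mul_pow, ← mul_pow, ← mul_pow]; norm_num

end HyenaRecall

theorem theorem5p1 (r : ℕ) (a : ℝ) :
    ∃ (c : ℕ) (C : ℝ), 1 ≤ c ∧ 0 < C ∧ ∀ s : ℕ, 2 ≤ s →
      (HyenaRecall.headWidth c s : ℝ) ≤ C * (Real.sqrt s * Real.log s) ∧
      ∀ M : ℕ, 1 ≤ M → (M : ℝ) ≤ a * Real.log s →
        ∀ h : Fin s → Fin (HyenaRecall.numBuckets c s),
          (∀ b, {i : Fin s | h i = b}.ncard ≤ ⌈Real.sqrt s⌉₊) →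
          ∀ (n : ℕ) (f : Fin s → Fin s) (q : Fin s) (x : Fin (2 * n + 1) → HyenaRecall.Token s),
            HyenaRecall.IsRecallInstance r f q x →
              1 - 1 / (s : ℝ) ≤ HyenaRecall.successProb M h f q x := by
  obtain ⟨A, hA⟩ := exists_nat_ge (max a 1)
  have hA1 : 1 ≤ A := by exact_mod_cast (le_max_right a 1).trans hA
  have haA : a ≤ A := (le_max_left a 1).trans hA
  -- Using `r + 1` keeps the number of buckets positive when `r = 0`.
  set ρ := r + 1 with hρ
  -- Chosen so that `256 * A * ρ ^ 2 * K = K ^ 2 / 2`, which is at most `exp K`.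
  set K := 512 * A * ρ ^ 2 with hK
  have hK1 : 1 ≤ K := Nat.one_le_iff_ne_zero.2 (by positivity)
  have hc : 1 ≤ 8 * ρ ^ 2 * K := Nat.one_le_iff_ne_zero.2 (by positivity)
  have hAK : 256 * A * (ρ : ℝ) ^ 2 * K ≤ Real.exp K := by
    refine le_of_eq_of_le ?_ (HyenaRecall.sq_div_two_le_exp (Nat.cast_nonneg K))
    rw [hK]
    push_cast
    ring
  refine ⟨8 * ρ ^ 2 * K, 8 * (8 * ρ ^ 2 * K : ℕ), hc, by positivity, fun s hs =>
    ⟨HyenaRecall.headWidth_le hs, fun M hM hMa h hh n f q x hx => ?_⟩⟩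
  have hlog : 0 ≤ Real.log s := Real.log_natCast_nonneg s
  have hP : 1 ≤ HyenaRecall.numBits s := HyenaRecall.one_le_numBits hs
  have hS : 0 < ⌈Real.sqrt s⌉₊ :=
    Nat.ceil_pos.2 (Real.sqrt_pos.2 (by exact_mod_cast (by omega : 0 < s)))
  have : NeZero (HyenaRecall.headWidth (8 * ρ ^ 2 * K) s) :=
    ⟨by rw [HyenaRecall.headWidth, HyenaRecall.numBuckets]; positivity⟩
  have hx' : HyenaRecall.IsRecallInstance ρ f q x :=
    ⟨hx.pair, hx.query, hx.query_mem, fun b => (hx.mult b).trans (Nat.le_succ r)⟩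
  have hfail := HyenaRecall.union_bound_le_inv (ρ := ρ) hs (by omega) hK1 hA1
    (hMa.trans (by gcongr)) hAK
  have hsucc := HyenaRecall.one_sub_union_bound_le_successProb hM hh hx'
    (μ := 4 * K * HyenaRecall.numBits s) (by positivity)
  linarith
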